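/- **Setup.** Let $\mathcal Y,\mathcal Y_1,\dots,\mathcal Y_t$ ($t\ge 2$) be smooth projective curves over $\mathbb F_q$ with separable maps $h_j:\mathcal Y_j\to\mathcal Y$ of degree $d_{h_j}$, such that $\mathbb F_q$ is the full field of constants of each $\mathbb F_q(\mathcal Y_j)$ and the extensions $\mathbb F_q(\mathcal Y_j)/\mathbb F_q(\mathcal Y)$ are linearly disjoint (each one from the compositum of the others). Let $\mathcal X=\mathcal Y_1\times_{\mathcal Y}\cdots\times_{\mathcal Y}\mathcal Y_t$ be the fiber product, that is, the curve whose function field is the compositum of the $\mathbb F_q(\mathcal Y_j)$ and whose closed points are the places of that field, and let $g:\mathcal X\to\mathcal Y$ be the natural map, of degree $d_g=[\mathbb F_q(\mathcal X):\mathbb F_q(\mathcal Y)]$. For each $j$ let $y_j$ be a primitive element of $\mathbb F_q(\mathcal Y_j)/\mathbb F_q(\mathcal Y)$. Let $D$ be an effective divisor on $\mathcal Y$ and let $S\subseteq\mathcal Y(\mathbb F_q)$ be a finite non-empty set such that, for every $P\in S$: * $|g^{-1}(P)\cap\mathcal X(\mathbb F_q)|=d_g$; * no $y_j$ has a pole at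 a point of $\mathcal X$ above $P$; * $P\notin\operatorname{Supp}(D)$; * two points $Q,Q'\in g^{-1}(P)\cap\mathcal X(\mathbb F_q)$ with $y_i(Q)=y_i(Q')$ for all $i\in\{1,\dots,t\}$ are equal. Put $B=g^{-1}(S)\cap\mathcal X(\mathbb F_q)=\{Q_1,\dots,Q_n\}$, let $\rho_1,\dots,\rho_t$ be integers with $1\le\rho_i\le d_{h_i}$, let $$V=\operatorname{Span}_{\mathbb F_q}\{f\,y_1^{e_1}\cdots y_t^{e_t}: f\in\mathcal L(\mathcal Y,D),\ 0\le e_i\le d_{h_i}-\rho_i \text{ for all } i\},$$ where $\mathcal L(\mathcal Y,D)$ is the Riemann–Roch space of $D$, and let $C(D,B)=\{(f(Q_1),\dots,f(Q_n)): f\in V\}\subseteq\mathbb F_q^n$. **Hierarchical locality.** Let $n,n_1,n_2,s_1,s_2,\delta_1,\delta_2$ be positive integers with $n_2<n_1$, $s_2\le s_1$, $\delta_2<\delta_1$. A linear code $C$ of length $n$ has hierarchical locality with parameters $((n_1,s_1,\delta_1),(n_2,s_2,\delta_2))$ if every position $i$ lies in a set $I$ of $n_1$ positions such that the punctured code $C|_I$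 has dimension at most $s_1$ and minimum distance at least $\delta_1$, and every position of $I$ lies in a set $J\subseteq I$ of size $n_2\le s_2+\delta_2-1$ such that $C|_J$ has minimum distance at least $\delta_2$. **Theorem.** For any $j\ne k$ in $\{1,\dots,t\}$ with $\rho_k\ge 2$, the code $C(D,B)$ has hierarchical locality with parameters $$n_1=d_{h_j}d_{h_k},\quad s_1=(d_{h_j}-\rho_j+1)(d_{h_k}-\rho_k+1),\quad \delta_1=\rho_j\rho_k,$$ $$n_2=d_{h_j},\quad s_2=d_{h_j}-\rho_j+1,\quad \delta_2=\rho_j .$$ -/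

import Mathlib

open scoped WithZero

noncomputable section

/-! ### Linear codes -/

namespace LinCode

variable {k : Type*} [Field k] [DecidableEq k]

/-- The punctured code `C|_I = {(c_i)_{i ∈ I} : c ∈ C}`, with set of positions `I`. -/
def puncture {ι : Type*} (C : Submodule k (ι → k)) (I : Finset ι) : Submodule k (I → k) :=
  C.map (LinearMap.funLeft k k (Subtype.val : I → ι))

/-- Any two distinct codewords differ in at least `δ` positions. -/
def MinDistGE {ι : Type*} [Fintype ι] (C : Submodule k (ι → k)) (δ : ℕ) : Prop :=
  ∀ a ∈ C, ∀ b ∈ C, a ≠ b → δ ≤ hammingDist a b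

/-- `C` is `(r, ρ)`-locally recoverable, with all repair groups of size exactly `m`: every position
lies in a set `J` of `m ≤ r + ρ - 1` positions such that `C|_J` has minimum distance at
least `ρ`. -/
def LocallyRecoverable {ι : Type*} (C : Submodule k (ι → k)) (r ρ m : ℕ) : Prop :=
  ∀ i : ι, ∃ J : Finset ι, i ∈ J ∧ J.card = m ∧ J.card + 1 ≤ r + ρ ∧ MinDistGE (puncture C J) ρ

/-- Hierarchical locality of a code of length `n`, with parameters
`((n₁, s₁, δ₁), (n₂, s₂, δ₂))`. -/
structure HierarchicalLocality {n : ℕ} (C : Submodule k (Fin n → k))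
    (n₁ s₁ δ₁ n₂ s₂ δ₂ : ℕ) : Prop where
  n_pos : 0 < n
  n₂_pos : 0 < n₂
  s₂_pos : 0 < s₂
  δ₂_pos : 0 < δ₂
  n_lt : n₂ < n₁
  s_le : s₂ ≤ s₁
  δ_lt : δ₂ < δ₁
  middle : ∀ i : Fin n, ∃ I : Finset (Fin n), i ∈ I ∧ I.card = n₁ ∧
    Module.finrank k (puncture C I) ≤ s₁ ∧ MinDistGE (puncture C I) δ₁ ∧
    LocallyRecoverable (puncture C I) s₂ δ₂ n₂

end LinCode

/-! ### Curves through their function fields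

A smooth projective curve over `k` is given by its function field `K / k`; its closed points are the
places of `K / k`, that is, the normalized discrete valuations of `K` that are trivial on `k`. -/

namespace Curve

/-- `K / k` is an algebraic function field of one variable. -/
def IsFunctionField (k K : Type*) [Field k] [Field K] [Algebra k K] : Prop :=
  ∃ x : K, Transcendental k x ∧ FiniteDimensional (IntermediateField.adjoin k {x}) K

/-- A closed point of the curve with function field `K`. The valuation is written
multiplicatively: the order `ord_P f` of `f ≠ 0` at the point is the integer `m` with
`val f = WithZero.exp (-m)`. -/
@[ext]
structure Place (k K : Type*) [Field k] [Field K] [Algebra k K] where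
  val : Valuation K ℤᵐ⁰
  normalized : Function.Surjective val
  trivial_on_constants : ∀ c : k, c ≠ 0 → val (algebraMap k K c) = 1

variable {k K : Type*} [Field k] [Field K] [Algebra k K]

/-- The function `f` is regular at `P` with value `c ∈ k` there. -/
def Place.HasValue (P : Place k K) (f : K) (c : k) : Prop :=
  P.val (f - algebraMap k K c) < 1

/-- `P` is a `k`-rational point: its residue field is `k`. -/
def Place.IsRational (P : Place k K) : Prop :=
  ∀ f : K, P.val f ≤ 1 → ∃ c : k, P.HasValue f c

/-- For `K ⊆ F`, the point `Q` of the curve of `F` maps to the point `P` of the curve of `K` under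
the morphism of curves given by the inclusion. -/
def Place.LiesOver {F : Type*} [Field F] [Algebra k F] [Algebra K F]
    (Q : Place k F) (P : Place k K) : Prop :=
  (Q.val.comap (algebraMap K F)).IsEquiv P.val

theorem Place.val_const_le (P : Place k K) (c : k) : P.val (algebraMap k K c) ≤ 1 := by
  by_cases hc : c = 0
  · simp [hc]
  · exact (P.trivial_on_constants c hc).le

/-- The Riemann-Roch space `L(D) = {f : f = 0 or ord_P f ≥ -D(P) for all P}`. -/
def riemannRoch (D : Place k K →₀ ℤ) : Submodule k K where
  carrier := {f | ∀ P : Place k K, P.val f ≤ WithZero.exp (D P)}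
  zero_mem' := fun P => by simp
  add_mem' := fun {a b} ha hb P => (P.val.map_add a b).trans (max_le (ha P) (hb P))
  smul_mem' := fun c f hf P => by
    rw [Algebra.smul_def, map_mul]
    exact (mul_le_of_le_one_left' (P.val_const_le c)).trans (hf P)

/-- The points of `X(k)` in the fiber over `P`. -/
def rationalFiber (F : Type*) [Field F] [Algebra k F] [Algebra K F] (P : Place k K) :
    Set (Place k F) :=
  {Q | Q.IsRational ∧ Q.LiesOver P}

/-- The evaluation set `B = g⁻¹(S) ∩ X(k)`. -/
def evalPoints (F : Type*) [Field F] [Algebra k F] [Algebra K F] (S : Finset (Place k K)) :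
    Set (Place k F) :=
  {Q | Q.IsRational ∧ ∃ P ∈ S, Q.LiesOver P}

/-- The span of the functions `f y₁^{e₁} ⋯ y_t^{e_t}` with `f ∈ L(D)` and
`0 ≤ e_j ≤ d_j - ρ_j`. -/
def functionSpace {F : Type*} [Field F] [Algebra k F] [Algebra K F] {t : ℕ}
    (D : Place k K →₀ ℤ) (y : Fin t → F) (d ρ : Fin t → ℕ) : Submodule k F :=
  Submodule.span k {u | ∃ f ∈ riemannRoch D, ∃ e : Fin t → ℕ,
    (∀ j, e j + ρ j ≤ d j) ∧ u = algebraMap K F f * ∏ j, y j ^ e j}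

/-- The evaluation code of `V` at the points `Q₁, …, Q_n`: the words `(f(Q₁), …, f(Q_n))`,
`f ∈ V`. -/
def evalCode {F : Type*} [Field F] [Algebra k F] (V : Submodule k F) {n : ℕ}
    (Q : Fin n → Place k F) : Submodule k (Fin n → k) where
  carrier := {w | ∃ f ∈ V, ∀ i, (Q i).HasValue f (w i)}
  zero_mem' := ⟨0, V.zero_mem, fun i => by simp [Place.HasValue]⟩
  add_mem' := by
    rintro a b ⟨f, hf, hfa⟩ ⟨g, hg, hgb⟩
    refine ⟨f + g, V.add_mem hf hg, fun i => ?_⟩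
    have h : f + g - algebraMap k F ((a + b) i) =
        (f - algebraMap k F (a i)) + (g - algebraMap k F (b i)) := by
      simp only [Pi.add_apply, map_add]; ring
    unfold Place.HasValue
    rw [h]
    exact (Q i).val.map_add_lt (hfa i) (hgb i)
  smul_mem' := by
    rintro c a ⟨f, hf, hfa⟩
    refine ⟨c • f, V.smul_mem c hf, fun i => ?_⟩
    have h : c • f - algebraMap k F ((c • a) i) =
        algebraMap k F c * (f - algebraMap k F (a i)) := by
      simp only [Pi.smul_apply, smul_eq_mul, map_mul, Algebra.smul_def]; ring
    unfold Place.HasValue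
    rw [h, map_mul]
    exact (mul_le_of_le_one_left' ((Q i).val_const_le c)).trans_lt (hfa i)

end Curve

end

/-! By linear disjointness `d_g` is the product of the degrees `d_i` of the covers. Over a point `P`
of `S`, reducing a rescaled minimal polynomial of `y_i` shows that `y_i` takes at most `d_i` values
on the fiber. The `y_i` separate the `d_g` rational points, so the count forces the fiber to be a
full grid `∏ A_i` with `|A_i| = d_i` (`exists_grid_rationalFiber`). Freezing every coordinate except
`y_j` and `y_l` leaves points in bijection with `A_j × A_l`. Functions in `L(D)` are constant on the
fiber, so codewords there are polynomials of degree at most `d_j - ρ_j` and `d_l - ρ_l` in the two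
variables (`exists_hasValue_gridEval`). Counting coefficients bounds the dimension, and counting
zeros (`mul_le_card_filter_gridEval`) bounds the distance. The rows of this grid, where words are
univariate polynomials, are the repair groups of the lower level. -/

/-! ### Codes of bivariate polynomials evaluated on a grid -/

namespace LinCode

variable {k : Type*} [Field k]

/-- The value at `(a, b)` of the bivariate polynomial with coefficients `G`. -/
def gridEval {r s : ℕ} (G : Fin (r + 1) × Fin (s + 1) → k) (a b : k) : k :=
  ∑ x, G x * a ^ (x.1 : ℕ) * b ^ (x.2 : ℕ)

theorem card_sub_le_card_filter_eval_ne_zero [DecidableEq k] {p : Polynomial k} (hp : p ≠ 0) {m : ℕ}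
    (hm : p.natDegree ≤ m) (A : Finset k) : A.card - m ≤ {a ∈ A | p.eval a ≠ 0}.card := by
  have h1 : {a ∈ A | p.eval a = 0}.card ≤ m := by
    refine le_trans (Finset.card_le_card (t := p.roots.toFinset) ?_)
      ((Multiset.toFinset_card_le _).trans ((Polynomial.card_roots' p).trans hm))
    intro a ha
    simpa [hp] using (Finset.mem_filter.1 ha).2
  have h2 := Finset.card_filter_add_card_filter_not (s := A) (fun a => p.eval a = 0)
  simp only [ne_eq]
  omega

/-- With `b` fixed this is root counting in one variable. The point `a₀` only certifies that the
polynomial is nonzero and need not lie in `A`. -/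
theorem card_sub_le_card_filter_gridEval_left [DecidableEq k] {r s : ℕ}
    (G : Fin (r + 1) × Fin (s + 1) → k)
    (A : Finset k) {a₀ b : k} (h : gridEval G a₀ b ≠ 0) :
    A.card - r ≤ {a ∈ A | gridEval G a b ≠ 0}.card := by
  let p : Polynomial k :=
    ∑ x, Polynomial.C (G x * b ^ (x.2 : ℕ)) * Polynomial.X ^ (x.1 : ℕ)
  have hp : ∀ a, p.eval a = gridEval G a b := fun a => by
    simp only [p, gridEval, Polynomial.eval_finsetSum, Polynomial.eval_mul, Polynomial.eval_C,
      Polynomial.eval_pow, Polynomial.eval_X]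
    exact Finset.sum_congr rfl fun x _ => by ring
  have hp0 : p ≠ 0 := fun h0 => h (by rw [← hp, h0, Polynomial.eval_zero])
  have hdeg : p.natDegree ≤ r := Polynomial.natDegree_sum_le_of_forall_le _ _ fun x _ =>
    (Polynomial.natDegree_C_mul_X_pow_le _ _).trans (Nat.lt_succ_iff.1 x.1.2)
  simpa only [hp] using card_sub_le_card_filter_eval_ne_zero hp0 hdeg A

theorem gridEval_swap {r s : ℕ} (G : Fin (r + 1) × Fin (s + 1) → k) (a b : k) :
    gridEval (fun x => G x.swap) b a = gridEval G a b :=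
  Fintype.sum_equiv (Equiv.prodComm _ _) _ _ fun x => by simp; ring

theorem card_sub_le_card_filter_gridEval_right [DecidableEq k] {r s : ℕ}
    (G : Fin (r + 1) × Fin (s + 1) → k)
    (B : Finset k) {a b₀ : k} (h : gridEval G a b₀ ≠ 0) :
    B.card - s ≤ {b ∈ B | gridEval G a b ≠ 0}.card := by
  rw [← gridEval_swap] at h
  simpa only [gridEval_swap] using card_sub_le_card_filter_gridEval_left _ B h

/-- On the line through `b₀` at least `|A| - r` values of `a` give a nonzero value; each certifies a
nonzero polynomial in `b`, with at least `|B| - s` non-roots in `B`. -/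
theorem mul_le_card_filter_gridEval [DecidableEq k] {r s : ℕ}
    (G : Fin (r + 1) × Fin (s + 1) → k)
    (A B : Finset k) {a₀ b₀ : k} (h : gridEval G a₀ b₀ ≠ 0) :
    (A.card - r) * (B.card - s) ≤ {x ∈ A ×ˢ B | gridEval G x.1 x.2 ≠ 0}.card := by
  calc (A.card - r) * (B.card - s)
      ≤ {a ∈ A | gridEval G a b₀ ≠ 0}.card * (B.card - s) :=
        Nat.mul_le_mul_right _ (card_sub_le_card_filter_gridEval_left G A h)
    _ ≤ ∑ a ∈ A with gridEval G a b₀ ≠ 0, {b ∈ B | gridEval G a b ≠ 0}.card :=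
        Finset.card_nsmul_le_sum _ _ _ fun a ha =>
          card_sub_le_card_filter_gridEval_right G B (Finset.mem_filter.1 ha).2
    _ ≤ ∑ a ∈ A, {b ∈ B | gridEval G a b ≠ 0}.card :=
        Finset.sum_le_sum_of_subset (Finset.filter_subset _ _)
    _ = {x ∈ A ×ˢ B | gridEval G x.1 x.2 ≠ 0}.card := by
        simp only [Finset.card_filter, Finset.sum_product]

theorem minDistGE_of_forall_ne_zero [DecidableEq k] {ι : Type*} [Fintype ι] {C : Submodule k (ι → k)} {δ : ℕ}
    (h : ∀ w ∈ C, w ≠ 0 → δ ≤ hammingNorm w) : MinDistGE C δ := fun a ha b hb hab => by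
  rw [hammingDist_comm, hammingDist_eq_hammingNorm, neg_add_eq_sub]
  exact h _ (C.sub_mem ha hb) (sub_ne_zero.2 hab)

/-! ### Parameters of a code whose words are bivariate polynomials on a grid. -/

section Grid

variable {ι : Type*} {C : Submodule k (ι → k)} {A B : Finset k} {u v : ι → k}
  {r s : ℕ}

theorem finrank_le_of_gridEval
    (hC : ∀ w ∈ C, ∃ G : Fin (r + 1) × Fin (s + 1) → k, ∀ i, w i = gridEval G (u i) (v i)) :
    Module.finrank k C ≤ (r + 1) * (s + 1) := by
  let φ : (Fin (r + 1) × Fin (s + 1) → k) →ₗ[k] (ι → k) :=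
    { toFun := fun G i => gridEval G (u i) (v i)
      map_add' := fun G H => by
        ext i
        simp only [gridEval, Pi.add_apply, add_mul, Finset.sum_add_distrib]
      map_smul' := fun c G => by
        ext i
        simp only [gridEval, Pi.smul_apply, smul_eq_mul, Finset.mul_sum, RingHom.id_apply,
          mul_assoc] }
  have hle : C ≤ LinearMap.range φ := fun w hw => by
    obtain ⟨G, hG⟩ := hC w hw
    exact ⟨G, funext fun i => (hG i).symm⟩
  refine (Submodule.finrank_mono hle).trans ((LinearMap.finrank_range_le φ).trans ?_)
  simp

theorem card_filter_grid {k ι : Type*} [Fintype ι] {A B : Finset k} {u v : ι → k}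
    (huv : Set.BijOn (fun i => (u i, v i)) Set.univ (A ×ˢ B : Finset (k × k)))
    (p : k × k → Prop) [DecidablePred p] :
    (Finset.univ.filter fun i => p (u i, v i)).card = {x ∈ A ×ˢ B | p x}.card := by
  refine Finset.card_bij (fun i _ => (u i, v i)) (fun i hi => ?_) (fun i _ i' _ h => ?_)
    fun x hx => ?_
  · exact Finset.mem_filter.2 ⟨huv.mapsTo (Set.mem_univ i), (Finset.mem_filter.1 hi).2⟩
  · exact huv.injOn (Set.mem_univ i) (Set.mem_univ i') h
  · obtain ⟨hx, hpx⟩ := Finset.mem_filter.1 hx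
    obtain ⟨i, -, rfl⟩ := huv.surjOn hx
    exact ⟨i, by simpa using hpx, rfl⟩

theorem minDistGE_of_gridEval [Fintype ι] [DecidableEq k]
    (huv : Set.BijOn (fun i => (u i, v i)) Set.univ (A ×ˢ B : Finset (k × k)))
    (hC : ∀ w ∈ C, ∃ G : Fin (r + 1) × Fin (s + 1) → k, ∀ i, w i = gridEval G (u i) (v i)) :
    MinDistGE C ((A.card - r) * (B.card - s)) := by
  refine minDistGE_of_forall_ne_zero fun w hw hw0 => ?_
  obtain ⟨G, hG⟩ := hC w hw
  obtain ⟨i, hi⟩ := Function.ne_iff.1 hw0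
  rw [Pi.zero_apply, hG] at hi
  have h := mul_le_card_filter_gridEval G A B hi
  rw [← card_filter_grid huv fun x => gridEval G x.1 x.2 ≠ 0] at h
  simpa only [hammingNorm, hG] using h

/-- The repair group of a position is its row `v = v i`, in bijection with `A`. Words restricted to
it are polynomials of degree at most `r` in `u`, so the row attains the Singleton-type size bound
with equality. -/
theorem locallyRecoverable_of_gridEval [Fintype ι] [DecidableEq k]
    (huv : Set.BijOn (fun i => (u i, v i)) Set.univ (A ×ˢ B : Finset (k × k)))
    (hC : ∀ w ∈ C, ∃ G : Fin (r + 1) × Fin (s + 1) → k, ∀ i, w i = gridEval G (u i) (v i))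
    (hr : r ≤ A.card) :
    LocallyRecoverable C (r + 1) (A.card - r) A.card := by
  intro i
  have hi := Finset.mem_product.1 (huv.mapsTo (Set.mem_univ i))
  have hrow : ∀ p : k → Prop, ∀ [DecidablePred p],
      (Finset.univ.filter fun i' => v i' = v i ∧ p (u i')).card = {a ∈ A | p a}.card := by
    intro p _
    rw [card_filter_grid huv fun x => x.2 = v i ∧ p x.1]
    refine Finset.card_bij (fun x _ => x.1) (fun x hx => ?_) (fun x hx x' hx' h => ?_)
      fun a ha => ?_
    · simp only [Finset.mem_filter, Finset.mem_product] at hx ⊢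
      exact ⟨hx.1.1, hx.2.2⟩
    · simp only [Finset.mem_filter] at hx hx'
      exact Prod.ext h (hx.2.1.trans hx'.2.1.symm)
    · rw [Finset.mem_filter] at ha
      exact ⟨(a, v i), by simpa [ha.1, ha.2] using hi.2, rfl⟩
  have hcard : (Finset.univ.filter fun i' => v i' = v i).card = A.card := by
    simpa using hrow fun _ => True
  refine ⟨Finset.univ.filter fun i' => v i' = v i, by simp, hcard, by omega, ?_⟩
  refine minDistGE_of_forall_ne_zero ?_
  rintro _ ⟨w, hw, rfl⟩ hw0
  obtain ⟨G, hG⟩ := hC w hw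
  obtain ⟨⟨i', hi'⟩, hne⟩ := Function.ne_iff.1 hw0
  have hv := (Finset.mem_filter.1 hi').2
  have hne' : gridEval G (u i') (v i) ≠ 0 := by
    rw [← hv, ← hG]
    exact hne
  have h := card_sub_le_card_filter_gridEval_left G A hne'
  rw [← hrow] at h
  refine h.trans (Finset.card_le_card_of_surjOn (fun x => x.1) ?_)
  intro x hx
  have hx' := (Finset.mem_filter.1 hx).2
  refine ⟨⟨x, by simpa using hx'.1⟩, ?_, rfl⟩
  have : w x ≠ 0 := by rw [hG, hx'.1]; exact hx'.2
  exact Finset.mem_coe.2 (Finset.mem_filter.2 ⟨Finset.mem_univ _, this⟩)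

end Grid

end LinCode

/-! ### Values of functions at points -/

namespace Curve

variable {k K F : Type*} [Field k] [Field K] [Field F] [Algebra k K] [Algebra k F] [Algebra K F]

namespace Place

variable {P : Place k K} {f g : K} {a b : k}

theorem HasValue.val_le_one (h : P.HasValue f a) : P.val f ≤ 1 := by
  have := (P.val.map_add (f - algebraMap k K a) (algebraMap k K a)).trans
    (max_le h.le (P.val_const_le a))
  rwa [sub_add_cancel] at this

theorem hasValue_algebraMap (P : Place k K) (a : k) : P.HasValue (algebraMap k K a) a := by
  simp [HasValue]

theorem HasValue.add (hf : P.HasValue f a) (hg : P.HasValue g b) :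
    P.HasValue (f + g) (a + b) := by
  have h : f + g - algebraMap k K (a + b) = (f - algebraMap k K a) + (g - algebraMap k K b) := by
    rw [map_add]; ring
  rw [HasValue, h]
  exact P.val.map_add_lt hf hg

theorem HasValue.mul (hf : P.HasValue f a) (hg : P.HasValue g b) :
    P.HasValue (f * g) (a * b) := by
  have h : f * g - algebraMap k K (a * b) =
      (f - algebraMap k K a) * g + algebraMap k K a * (g - algebraMap k K b) := by
    rw [map_mul]; ring
  rw [HasValue, h]
  refine P.val.map_add_lt ?_ ?_
  · rw [map_mul]
    exact (mul_le_of_le_one_right' hg.val_le_one).trans_lt hf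
  · rw [map_mul]
    exact (mul_le_of_le_one_left' (P.val_const_le a)).trans_lt hg

theorem HasValue.pow (hf : P.HasValue f a) (m : ℕ) : P.HasValue (f ^ m) (a ^ m) := by
  induction m with
  | zero => simpa using P.hasValue_algebraMap 1
  | succ m ih => simpa only [pow_succ] using ih.mul hf

theorem HasValue.sum {ι : Type*} (s : Finset ι) {f : ι → K} {a : ι → k}
    (h : ∀ i ∈ s, P.HasValue (f i) (a i)) : P.HasValue (∑ i ∈ s, f i) (∑ i ∈ s, a i) := by
  classical
  induction s using Finset.induction_on with
  | empty => simpa using P.hasValue_algebraMap 0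
  | insert i s hi ih =>
    rw [Finset.sum_insert hi, Finset.sum_insert hi]
    exact (h i (s.mem_insert_self i)).add (ih fun i' hi' => h i' (Finset.mem_insert_of_mem hi'))

theorem HasValue.prod {ι : Type*} (s : Finset ι) {f : ι → K} {a : ι → k}
    (h : ∀ i ∈ s, P.HasValue (f i) (a i)) : P.HasValue (∏ i ∈ s, f i) (∏ i ∈ s, a i) := by
  classical
  induction s using Finset.induction_on with
  | empty => simpa using P.hasValue_algebraMap 1
  | insert i s hi ih =>
    rw [Finset.prod_insert hi, Finset.prod_insert hi]
    exact (h i (s.mem_insert_self i)).mul (ih fun i' hi' => h i' (Finset.mem_insert_of_mem hi'))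

theorem HasValue.unique (ha : P.HasValue f a) (hb : P.HasValue f b) : a = b := by
  by_contra hab
  have h1 := P.trivial_on_constants (b - a) (sub_ne_zero.2 (Ne.symm hab))
  have h2 : algebraMap k K (b - a) = (f - algebraMap k K a) - (f - algebraMap k K b) := by
    rw [map_sub]; ring
  have h3 := P.val.map_sub_lt ha hb
  rw [← h2, h1] at h3
  exact lt_irrefl _ h3

/-- Having a value only compares a valuation with `1`, so equivalence of valuations suffices and the
ramification index plays no role. -/
theorem HasValue.of_liesOver [IsScalarTower k K F] {Q : Place k F} (hQ : Q.LiesOver P)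
    (h : P.HasValue f a) : Q.HasValue (algebraMap K F f) a := by
  have h' := (Valuation.isEquiv_iff_val_lt_one.1 hQ (x := f - algebraMap k K a)).2 h
  rwa [Valuation.comap_apply, map_sub, ← IsScalarTower.algebraMap_apply] at h'

end Place

/-! ### The fiber over a totally split point as a grid. -/

/-- A function algebraic over `K` takes at most as many values as its degree at the points
above a rational point: they are roots of the reduction of a primitive multiple of its minimal
polynomial. -/
theorem exists_polynomial_eval_eq_zero_of_liesOver [IsScalarTower k K F] {P : Place k K}
    (hP : P.IsRational) {z : F} (hz : IsIntegral K z) :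
    ∃ p : Polynomial k, p ≠ 0 ∧ p.natDegree ≤ (minpoly K z).natDegree ∧
      ∀ Q : Place k F, Q.LiesOver P → ∀ c, Q.HasValue z c → p.eval c = 0 := by
  set m := minpoly K z with hm
  set N := m.natDegree
  -- Dividing by a coefficient of largest valuation makes all coefficients regular at `P` and one of
  -- them equal to `1`, so the reduction is nonzero, although its degree may drop.
  obtain ⟨i₀, hi₀, hmax⟩ := Finset.exists_max_image (Finset.range (N + 1))
    (fun i => P.val (m.coeff i)) ⟨0, by simp⟩
  have hpos : m.coeff i₀ ≠ 0 := by
    intro h0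
    have h1 := hmax N (by simp)
    rw [h0, map_zero, show m.coeff N = 1 from minpoly.monic hz, map_one] at h1
    exact absurd h1 (by simp)
  have hval : ∀ i ∈ Finset.range (N + 1), P.val (m.coeff i / m.coeff i₀) ≤ 1 := fun i hi => by
    rw [map_div₀]
    exact div_le_one_of_le₀ (hmax i hi) zero_le
  have hex : ∀ i, ∃ c, i ∈ Finset.range (N + 1) → P.HasValue (m.coeff i / m.coeff i₀) c := by
    intro i
    by_cases hi : i ∈ Finset.range (N + 1)
    · obtain ⟨c, hc⟩ := hP _ (hval i hi)
      exact ⟨c, fun _ => hc⟩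
    · exact ⟨0, fun h => absurd h hi⟩
  choose r hr using hex
  have hr1 : r i₀ = 1 := by
    have h1 := hr i₀ hi₀
    rw [div_self hpos] at h1
    exact h1.unique (by simpa using P.hasValue_algebraMap 1)
  refine ⟨∑ i ∈ Finset.range (N + 1), Polynomial.C (r i) * Polynomial.X ^ i, fun h0 => ?_,
    ?_, fun Q hQ c hc => ?_⟩
  · have h1 := congrArg (Polynomial.coeff · i₀) h0
    simp only [Polynomial.finsetSum_coeff, Polynomial.coeff_C_mul_X_pow, Finset.sum_ite_eq,
      hi₀, if_true, hr1, Polynomial.coeff_zero] at h1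
    exact one_ne_zero h1
  · exact Polynomial.natDegree_sum_le_of_forall_le _ _ fun i hi =>
      (Polynomial.natDegree_C_mul_X_pow_le _ _).trans (Nat.lt_succ_iff.1 (Finset.mem_range.1 hi))
  · have h1 : Q.HasValue
        (∑ i ∈ Finset.range (N + 1), algebraMap K F (m.coeff i / m.coeff i₀) * z ^ i)
        (∑ i ∈ Finset.range (N + 1), r i * c ^ i) :=
      Place.HasValue.sum _ fun i hi => ((hr i hi).of_liesOver hQ).mul (hc.pow i)
    have h2 : ∑ i ∈ Finset.range (N + 1), algebraMap K F (m.coeff i / m.coeff i₀) * z ^ i = 0 := by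
      have h3 : ∑ i ∈ Finset.range (N + 1), algebraMap K F (m.coeff i) * z ^ i = 0 := by
        have h4 : Polynomial.aeval z m = 0 := minpoly.aeval K z
        rw [Polynomial.aeval_eq_sum_range] at h4
        simpa only [Algebra.smul_def] using h4
      calc _ = (algebraMap K F (m.coeff i₀))⁻¹ *
            ∑ i ∈ Finset.range (N + 1), algebraMap K F (m.coeff i) * z ^ i := by
              rw [Finset.mul_sum]
              refine Finset.sum_congr rfl fun i _ => ?_
              rw [map_div₀]; ring
        _ = 0 := by rw [h3, mul_zero]
    rw [h2] at h1
    simp only [Polynomial.eval_finsetSum, Polynomial.eval_mul, Polynomial.eval_C,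
      Polynomial.eval_pow, Polynomial.eval_X]
    exact h1.unique (by simpa using Q.hasValue_algebraMap 0)

/-- A totally split fiber whose points are separated by `y₁, …, y_t` is a grid in the
coordinates `y₁, …, y_t`. -/
theorem exists_grid_rationalFiber [IsScalarTower k K F] {t : ℕ} {P : Place k K}
    (hP : P.IsRational) {y : Fin t → F} (hy : ∀ j, IsIntegral K (y j))
    (hcard : (rationalFiber F P).ncard = ∏ j, (minpoly K (y j)).natDegree)
    (hpole : ∀ Q : Place k F, Q.LiesOver P → ∀ j, Q.val (y j) ≤ 1)
    (hsep : ∀ Q ∈ rationalFiber F P, ∀ Q' ∈ rationalFiber F P,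
      (∀ j, ∃ c : k, Q.HasValue (y j) c ∧ Q'.HasValue (y j) c) → Q = Q') :
    ∃ A : Fin t → Finset k, (∀ j, (A j).card = (minpoly K (y j)).natDegree) ∧
      (∀ Q ∈ rationalFiber F P, ∀ j c, Q.HasValue (y j) c → c ∈ A j) ∧
      ∀ a : Fin t → k, (∀ j, a j ∈ A j) →
        ∃ Q ∈ rationalFiber F P, ∀ j, Q.HasValue (y j) (a j) := by
  classical
  have hdpos : ∀ j, 0 < (minpoly K (y j)).natDegree := fun j => minpoly.natDegree_pos (hy j)
  choose p hp0 hpdeg hproot using fun j => exists_polynomial_eval_eq_zero_of_liesOver (F := F) hP (hy j)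
  -- `ncard` is `0` on infinite sets, so a positive value forces finiteness.
  have hfin : (rationalFiber F P).Finite :=
    Set.finite_of_ncard_pos (hcard ▸ Finset.prod_pos fun j _ => hdpos j)
  have hex : ∀ Q : Place k F, ∃ c : Fin t → k, Q ∈ rationalFiber F P →
      ∀ j, Q.HasValue (y j) (c j) := by
    intro Q
    by_cases hQ : Q ∈ rationalFiber F P
    · choose c hc using fun j => hQ.1 (y j) (hpole Q hQ.2 j)
      exact ⟨c, fun _ => hc⟩
    · exact ⟨0, fun h => absurd h hQ⟩
  choose ev hev using hex
  let A : Fin t → Finset k := fun j => (p j).roots.toFinset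
  have hA : ∀ Q ∈ rationalFiber F P, ∀ j c, Q.HasValue (y j) c → c ∈ A j := by
    intro Q hQ j c hc
    simpa [A, hp0 j] using hproot j Q hQ.2 c hc
  have hAle : ∀ j, (A j).card ≤ (minpoly K (y j)).natDegree := fun j =>
    (Multiset.toFinset_card_le _).trans ((Polynomial.card_roots' _).trans (hpdeg j))
  have hmaps : Set.MapsTo ev hfin.toFinset (Fintype.piFinset A) := fun Q hQ => by
    have hQ' : Q ∈ rationalFiber F P := by simpa using hQ
    simp only [Finset.mem_coe, Fintype.mem_piFinset]
    exact fun j => hA Q hQ' j _ (hev Q hQ' j)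
  have hinj : Set.InjOn ev hfin.toFinset := fun Q hQ Q' hQ' h => by
    have h1 : Q ∈ rationalFiber F P := by simpa using hQ
    have h2 : Q' ∈ rationalFiber F P := by simpa using hQ'
    exact hsep Q h1 Q' h2 fun j => ⟨ev Q j, hev Q h1 j, h ▸ hev Q' h2 j⟩
  have hfc : hfin.toFinset.card = ∏ j, (minpoly K (y j)).natDegree := by
    rw [← hcard, Set.ncard_eq_toFinset_card _ hfin]
  -- The injection gives `∏ d_i ≤ ∏ |A_i|`. Together with `|A_i| ≤ d_i` this forces equality in
  -- every factor, and then the injection is onto.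
  have hle := Finset.card_le_card_of_injOn ev hmaps hinj
  rw [hfc, Fintype.card_piFinset] at hle
  have hApos : ∀ j, 0 < (A j).card := fun j => Nat.pos_of_ne_zero fun h0 => by
    rw [Finset.prod_eq_zero (f := fun j => (A j).card) (Finset.mem_univ j) h0] at hle
    exact absurd hle (not_le.2 (Finset.prod_pos fun j _ => hdpos j))
  have hAcard : ∀ j, (A j).card = (minpoly K (y j)).natDegree := fun j => by
    by_contra hne
    exact absurd hle (not_le.2 (Finset.prod_lt_prod (fun j _ => hApos j) (fun j _ => hAle j)
      ⟨j, Finset.mem_univ j, lt_of_le_of_ne (hAle j) hne⟩))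
  refine ⟨A, hAcard, hA, fun a ha => ?_⟩
  have hsurj := Finset.surjOn_of_injOn_of_card_le ev hmaps hinj
    (by rw [hfc, Fintype.card_piFinset]; exact Finset.prod_le_prod' fun j _ => hAle j)
  obtain ⟨Q, hQ, rfl⟩ := hsurj (by simpa using ha : a ∈ (Fintype.piFinset A : Set (Fin t → k)))
  have hQ' : Q ∈ rationalFiber F P := by simpa using hQ
  exact ⟨Q, hQ', hev Q hQ'⟩

/-- On the points above `P` with prescribed `y_i`, `i ≠ j, l`, the functions of the space are
polynomials in `y_j` and `y_l`. -/
theorem exists_hasValue_gridEval [IsScalarTower k K F] {t : ℕ} {P : Place k K}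
    (hP : P.IsRational) {D : Place k K →₀ ℤ} (hD : D P = 0) {y : Fin t → F} {d ρ : Fin t → ℕ}
    {j l : Fin t} (hjl : j ≠ l) (a : Fin t → k) {f : F} (hf : f ∈ functionSpace D y d ρ) :
    ∃ G : Fin (d j - ρ j + 1) × Fin (d l - ρ l + 1) → k, ∀ Q : Place k F, Q.LiesOver P →
      ∀ b c, (∀ i, Q.HasValue (y i) (Function.update (Function.update a j b) l c i)) →
        Q.HasValue f (LinCode.gridEval G b c) := by
  classical
  induction hf using Submodule.span_induction with
  | mem f hf =>
    obtain ⟨g, hg, e, he, rfl⟩ := hf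
    -- Since `D P = 0`, `g` is regular at `P`; its value there is shared by all points above `P`.
    have hgP : P.val g ≤ 1 := by simpa [hD] using hg P
    obtain ⟨γ, hγ⟩ := hP g hgP
    have hj := he j
    have hl := he l
    -- A generator becomes one monomial in `b` and `c`; the value of `g` and the frozen coordinates
    -- go into its coefficient.
    refine ⟨Pi.single (⟨e j, by omega⟩, ⟨e l, by omega⟩)
      (γ * ∏ i ∈ (Finset.univ.erase j).erase l, a i ^ e i), fun Q hQ b c h => ?_⟩
    have h1 := (hγ.of_liesOver hQ).mul
      (Place.HasValue.prod Finset.univ fun i _ => (h i).pow (e i))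
    convert h1 using 1
    rw [LinCode.gridEval, Finset.sum_eq_single (⟨e j, by omega⟩, ⟨e l, by omega⟩)
      (fun x _ hx => by rw [Pi.single_eq_of_ne hx, zero_mul, zero_mul])
      (fun h => absurd (Finset.mem_univ _) h), Pi.single_eq_same,
      ← Finset.mul_prod_erase Finset.univ _ (Finset.mem_univ j),
      ← Finset.mul_prod_erase (Finset.univ.erase j) _
        (Finset.mem_erase.2 ⟨hjl.symm, Finset.mem_univ l⟩)]
    have h2 : ∏ i ∈ (Finset.univ.erase j).erase l,
        Function.update (Function.update a j b) l c i ^ e i =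
        ∏ i ∈ (Finset.univ.erase j).erase l, a i ^ e i := by
      refine Finset.prod_congr rfl fun i hi => ?_
      simp only [Finset.mem_erase] at hi
      rw [Function.update_of_ne hi.1, Function.update_of_ne hi.2.1]
    rw [h2, Function.update_self, Function.update_of_ne hjl, Function.update_self]
    ring
  | zero =>
    refine ⟨0, fun Q hQ b c h => ?_⟩
    simpa [LinCode.gridEval] using Q.hasValue_algebraMap 0
  | add f g _ _ ihf ihg =>
    obtain ⟨G, hG⟩ := ihf
    obtain ⟨H, hH⟩ := ihg
    refine ⟨G + H, fun Q hQ b c h => ?_⟩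
    convert (hG Q hQ b c h).add (hH Q hQ b c h) using 1
    simp only [LinCode.gridEval, Pi.add_apply, add_mul, Finset.sum_add_distrib]
  | smul z f _ ih =>
    obtain ⟨G, hG⟩ := ih
    refine ⟨z • G, fun Q hQ b c h => ?_⟩
    rw [Algebra.smul_def]
    convert (Q.hasValue_algebraMap z).mul (hG Q hQ b c h) using 1
    simp only [LinCode.gridEval, Pi.smul_apply, smul_eq_mul, Finset.mul_sum, mul_assoc]

end Curve

/-- Fields are adjoined one at a time: `L j` is linearly disjoint from the compositum of all the
others, hence from that of any subfamily omitting `j`. -/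
theorem IntermediateField.finrank_biSup_of_linearDisjoint {K F ι : Type*} [Field K] [Field F]
    [Algebra K F] (L : ι → IntermediateField K F)
    (h : ∀ j, (L j).LinearDisjoint (⨆ i ≠ j, L i : IntermediateField K F)) (s : Finset ι) :
    Module.finrank K (⨆ i ∈ s, L i : IntermediateField K F) =
      ∏ i ∈ s, Module.finrank K (L i) := by
  classical
  induction s using Finset.induction_on with
  | empty => simp
  | insert j s hj ih =>
    rw [Finset.prod_insert hj, ← ih, Finset.iSup_insert]
    refine ((h j).of_le_right ?_).finrank_sup
    exact biSup_mono fun i hi hij => hj (hij ▸ hi)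

/-- `K = k(Y)`, `L j = k(Y_j)`, `F = k(X)` for the fiber product `X = Y_1 ×_Y ⋯ ×_Y Y_t`. -/
theorem mainTheorem3
    {k K F : Type*} [Field k] [Finite k] [DecidableEq k] [Field K] [Field F]
    [Algebra k K] [Algebra k F] [Algebra K F] [IsScalarTower k K F]
    -- the curve `Y`
    (hK : Curve.IsFunctionField k K)
    -- the covers `h_j : Y_j → Y`, of degree `d_{h_j} = [k(Y_j) : k(Y)]`
    (t : ℕ) (ht : 2 ≤ t) (L : Fin t → IntermediateField K F)
    (hfin : ∀ j, FiniteDimensional K (L j))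
    (hsep : ∀ j, Algebra.IsSeparable K (L j))
    -- `k` is the full field of constants of every `k(Y_j)`
    (hconst : ∀ j, ∀ x ∈ L j, IsAlgebraic k x → x ∈ (algebraMap k F).range)
    -- the `k(Y_j)` are linearly disjoint over `k(Y)`, with compositum `k(X)`
    (hdisj : ∀ j, (L j).LinearDisjoint (⨆ i ≠ j, L i : IntermediateField K F))
    (hcomp : ⨆ j, L j = ⊤)
    -- the primitive elements `y_j`
    (y : Fin t → F) (hy : ∀ j, IntermediateField.adjoin K {y j} = L j)
    -- the effective divisor `D` and the set `S` of rational points of `Y`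
    (D : Curve.Place k K →₀ ℤ) (hD : 0 ≤ D)
    (S : Finset (Curve.Place k K)) (hS : S.Nonempty) (hSrat : ∀ P ∈ S, P.IsRational)
    (hSfib : ∀ P ∈ S, (Curve.rationalFiber F P).ncard = Module.finrank K F)
    (hSpole : ∀ P ∈ S, ∀ Q : Curve.Place k F, Q.LiesOver P → ∀ j, Q.val (y j) ≤ 1)
    (hSD : ∀ P ∈ S, D P = 0)
    -- points of `B` are determined by their image in `Y` and their `y`-coordinates
    (hsepB : ∀ P ∈ S, ∀ Q ∈ Curve.rationalFiber F P, ∀ Q' ∈ Curve.rationalFiber F P,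
      (∀ j, ∃ c : k, Q.HasValue (y j) c ∧ Q'.HasValue (y j) c) → Q = Q')
    -- the enumeration `Q_1, …, Q_n` of `B`
    (n : ℕ) (Q : Fin n ≃ Curve.evalPoints F S)
    -- the locality parameters
    (ρ : Fin t → ℕ) (hρ : ∀ i, 1 ≤ ρ i ∧ ρ i ≤ Module.finrank K (L i))
    (j l : Fin t) (hjl : j ≠ l) (hρl : 2 ≤ ρ l) :
    LinCode.HierarchicalLocality
      (Curve.evalCode
        (Curve.functionSpace D y (fun i => Module.finrank K (L i)) ρ) (fun i => (Q i).1))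
      (Module.finrank K (L j) * Module.finrank K (L l))
      ((Module.finrank K (L j) - ρ j + 1) * (Module.finrank K (L l) - ρ l + 1))
      (ρ j * ρ l)
      (Module.finrank K (L j))
      (Module.finrank K (L j) - ρ j + 1)
      (ρ j) := by
  classical
  have hint : ∀ i, IsIntegral K (y i) := fun i => by
    have hmem : y i ∈ L i := by
      rw [← hy i]
      exact IntermediateField.mem_adjoin_simple_self K (y i)
    have := hfin i
    exact (Algebra.IsIntegral.isIntegral (R := K) (⟨y i, hmem⟩ : L i)).map (L i).val
  have hdeg : ∀ i, (minpoly K (y i)).natDegree = Module.finrank K (L i) := fun i => by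
    rw [← hy i, IntermediateField.adjoin.finrank (hint i)]
  have hprod : Module.finrank K F = ∏ i, Module.finrank K (L i) := by
    have h := IntermediateField.finrank_biSup_of_linearDisjoint L hdisj Finset.univ
    rw [← h, iSup_congr fun i => iSup_pos (Finset.mem_univ i), hcomp,
      IntermediateField.finrank_top']
  have hgrid : ∀ P ∈ S, _ := fun P hP =>
    Curve.exists_grid_rationalFiber (F := F) (hSrat P hP) hint
      (by simp only [hSfib P hP, hprod, hdeg]) (hSpole P hP) (hsepB P hP)
  simp only [hdeg] at hgrid
  have hρj := hρ j
  have hρl' := hρ l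
  refine
    { n_pos := ?_
      n₂_pos := by omega
      s₂_pos := by omega
      δ₂_pos := by omega
      -- Both strict inequalities come from `2 ≤ ρ l`, which also gives degree at least `2` for `L
      -- l`.
      n_lt := lt_mul_of_one_lt_right (by omega) (by omega)
      s_le := Nat.le_mul_of_pos_right _ (by omega)
      δ_lt := lt_mul_of_one_lt_right (by omega) (by omega)
      middle := fun i => ?_ }
  · obtain ⟨P, hP⟩ := hS
    obtain ⟨A, hA, -, hsurj⟩ := hgrid P hP
    have hne : ∀ m, (A m).Nonempty := fun m => Finset.card_pos.1 (by have := hρ m; rw [hA]; omega)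
    obtain ⟨q, hq, -⟩ := hsurj (fun m => (hne m).choose) fun m => (hne m).choose_spec
    exact Fin.pos (Q.symm ⟨q, hq.1, P, hP, hq.2⟩)
  obtain ⟨hrat, P, hP, hover⟩ := (Q i).2
  obtain ⟨A, hA, hmem, hsurj⟩ := hgrid P hP
  choose a ha using fun m => hrat (y m) (hSpole P hP _ hover m)
  have haA : ∀ m, a m ∈ A m := fun m => hmem _ ⟨hrat, hover⟩ m _ (ha m)
  set up : k → k → Fin t → k := fun b c => Function.update (Function.update a j b) l c with hup
  have hupj : ∀ b c, up b c j = b := fun b c => by simp [hup, hjl]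
  have hupl : ∀ b c, up b c l = c := fun b c => by simp [hup]
  -- The two-dimensional slice of the grid through the given point, in directions `j` and `l`.
  let I : Finset (Fin n) := Finset.univ.filter fun i' => (Q i').1.LiesOver P ∧
    ∃ b c, ∀ m, (Q i').1.HasValue (y m) (up b c m)
  have hI : ∀ i' : I, (Q i').1.LiesOver P ∧ ∃ b c, ∀ m, (Q i').1.HasValue (y m) (up b c m) :=
    fun i' => (Finset.mem_filter.1 i'.2).2
  choose hIP u v huv using hI
  have hbij : Set.BijOn (fun i' => (u i', v i')) Set.univ (A j ×ˢ A l : Finset (k × k)) := by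
    refine ⟨fun i' _ => ?_, fun i₁ _ i₂ _ h => ?_, fun x hx => ?_⟩
    · have hf : (Q i').1 ∈ Curve.rationalFiber F P := ⟨(Q i').2.1, hIP i'⟩
      have h1 := hmem _ hf j _ (huv i' j)
      have h2 := hmem _ hf l _ (huv i' l)
      rw [hupj] at h1
      rw [hupl] at h2
      exact Finset.mem_coe.2 (Finset.mem_product.2 ⟨h1, h2⟩)
    · obtain ⟨hu, hv⟩ := Prod.mk.inj h
      have := hsepB P hP _ ⟨(Q i₁).2.1, hIP i₁⟩ _ ⟨(Q i₂).2.1, hIP i₂⟩ fun m =>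
        ⟨_, huv i₁ m, by rw [hu, hv]; exact huv i₂ m⟩
      exact Subtype.ext (Q.injective (Subtype.ext this))
    · have hx' := Finset.mem_product.1 (Finset.mem_coe.1 hx)
      obtain ⟨q, hq, hqv⟩ := hsurj (up x.1 x.2) fun m => by
        by_cases hml : m = l
        · subst hml; rw [hupl]; exact hx'.2
        by_cases hmj : m = j
        · subst hmj; rw [hupj]; exact hx'.1
        simpa [hup, hml, hmj] using haA m
      let i' : Fin n := Q.symm ⟨q, hq.1, P, hP, hq.2⟩
      have hi' : (Q i').1 = q := by simp [i']
      have hi'I : i' ∈ I :=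
        Finset.mem_filter.2 ⟨Finset.mem_univ _, hi' ▸ hq.2, x.1, x.2, hi' ▸ hqv⟩
      refine ⟨⟨i', hi'I⟩, Set.mem_univ _, ?_⟩
      have hb := huv ⟨i', hi'I⟩
      simp only [hi'] at hb
      have h1 := (hb j).unique (hqv j)
      have h2 := (hb l).unique (hqv l)
      rw [hupj, hupj] at h1
      rw [hupl, hupl] at h2
      exact Prod.ext h1 h2
  have hcode : ∀ w ∈ LinCode.puncture (Curve.evalCode
      (Curve.functionSpace D y (fun i => Module.finrank K (L i)) ρ) (fun i => (Q i).1)) I,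
      ∃ G : Fin (Module.finrank K (L j) - ρ j + 1) × Fin (Module.finrank K (L l) - ρ l + 1) → k,
        ∀ i', w i' = LinCode.gridEval G (u i') (v i') := by
    rintro _ ⟨w, ⟨f, hf, hfw⟩, rfl⟩
    obtain ⟨G, hG⟩ := Curve.exists_hasValue_gridEval (hSrat P hP) (hSD P hP) hjl a hf
    exact ⟨G, fun i' => (hfw i').unique (hG _ (hIP i') _ _ (huv i'))⟩
  have hcard : I.card = Module.finrank K (L j) * Module.finrank K (L l) := by
    have h := LinCode.card_filter_grid hbij fun _ => True
    simpa [hA] using h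
  have hdist := LinCode.minDistGE_of_gridEval hbij hcode
  have hloc := LinCode.locallyRecoverable_of_gridEval hbij hcode (by rw [hA]; omega)
  -- As `ρ ≤ d`, the truncated difference `d - (d - ρ)` is exactly `ρ`.
  rw [hA, hA, Nat.sub_sub_self hρj.2, Nat.sub_sub_self hρl'.2] at hdist
  rw [hA, Nat.sub_sub_self hρj.2] at hloc
  refine ⟨I, ?_, hcard, LinCode.finrank_le_of_gridEval hcode, hdist, hloc⟩
  refine Finset.mem_filter.2 ⟨Finset.mem_univ _, hover, a j, a l, fun m => ?_⟩
  simpa [hup] using ha m
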